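/- Let $n,m\in\mathbb{N}$, let $\psi:\mathbb{R}^n\times\mathbb{R}^m\to\mathbb{R}$ be twice continuously differentiable, let $q:\mathbb{R}^m\to\overline{\mathbb{R}}$ be lower semicontinuous and proper (that is, $q>-\infty$ everywhere and $q\not\equiv+\infty$), and put $\varphi(x,y):=\psi(x,y)+q(y)$. Let $\Omega\subset\mathbb{R}^n$ be an open set such that for every $x\in\Omega$ the set $\operatorname{arg\,min}_{y\in\mathbb{R}^m}\varphi(x,y)$ of global minimizers is a singleton $\{\sigma(x)\}$. Assume that every $\bar x\in\Omega$ has a neighborhood $U$ such that the set $\{\sigma(x) : x\in U\cap\Omega\}$ is bounded. Then the mapping $\sigma$ is continuous on $\Omega$, and the function $\vartheta(x):=\min_{y\in\mathbb{R}^m}\varphi(x,y)$ is finite and continuously differentiable on $\Omega$ with $\nabla\vartheta(x)=\nabla_x\psi(x,\sigma(x))$ for every $x\in\Omega$. -/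

import Mathlib

/-- An extended real-valued function is proper if it never takes the value `-∞` and is not
identically `+∞`. -/
def IsProperFunction {X : Type*} (f : X → EReal) : Prop :=
  (∀ x, f x ≠ ⊥) ∧ ∃ x, f x ≠ ⊤

/-- The set of (global) minimizers of an extended real-valued function. -/
def argminSet {X : Type*} (f : X → EReal) : Set X :=
  {y | IsMinOn f Set.univ y}

/-- The decomposable objective `φ(x, y) = ψ(x, y) + q(y)`. -/
noncomputable def decomposableObjective {X Y : Type*} (ψ : X × Y → ℝ) (q : Y → EReal)
    (x : X) (y : Y) : EReal :=
  (ψ (x, y) : EReal) + q y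

/-- The value function `θ(x) = min_y φ(x, y)`, as an infimum in the extended reals. -/
noncomputable def valueFunction {X Y : Type*} (φ : X → Y → EReal) (x : X) : EReal :=
  ⨅ y, φ x y

open Filter Topology Set

section Minimizers

variable {X Y : Type*} {ψ : X × Y → ℝ} {q : Y → EReal} {x : X} {y : Y}

/-! Lower semicontinuity of `q` makes each cluster point of nearby minimizers a minimizer
(`mem_argminSet_of_mapClusterPt`); local boundedness gives compactness, so uniqueness forces `σ` to
be continuous. Testing each minimizer in the other's problem cancels `q` and squeezes the increment
of the value function between two increments of `ψ` in its first variable, which have the same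
linear part (`hasFDerivAt_of_sub_le`). -/

theorem mem_argminSet_iff {f : Y → EReal} : y ∈ argminSet f ↔ ∀ z, f y ≤ f z := by
  simp [argminSet, isMinOn_iff]

theorem IsProperFunction.ne_top_of_mem_argminSet (hq : IsProperFunction q)
    (hy : y ∈ argminSet (decomposableObjective ψ q x)) : q y ≠ ⊤ := by
  obtain ⟨z, hz⟩ := hq.2
  have h := mem_argminSet_iff.1 hy z
  intro hT
  simp only [decomposableObjective, hT, EReal.coe_add_top, top_le_iff] at h
  rw [← EReal.coe_toReal hz (hq.1 z), ← EReal.coe_add] at h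
  exact EReal.coe_ne_top _ h

theorem IsProperFunction.coe_toReal_of_mem_argminSet (hq : IsProperFunction q)
    (hy : y ∈ argminSet (decomposableObjective ψ q x)) : ((q y).toReal : EReal) = q y :=
  EReal.coe_toReal (hq.ne_top_of_mem_argminSet hy) (hq.1 y)

theorem valueFunction_eq_of_mem_argminSet {φ : X → Y → EReal} (hy : y ∈ argminSet (φ x)) :
    valueFunction φ x = φ x y :=
  le_antisymm (iInf_le _ y) (le_iInf (mem_argminSet_iff.1 hy))

theorem IsProperFunction.valueFunction_eq_coe (hq : IsProperFunction q)
    (hy : y ∈ argminSet (decomposableObjective ψ q x)) :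
    valueFunction (decomposableObjective ψ q) x = ((ψ (x, y) + (q y).toReal : ℝ) : EReal) := by
  rw [valueFunction_eq_of_mem_argminSet hy, EReal.coe_add, hq.coe_toReal_of_mem_argminSet hy,
    decomposableObjective]

theorem IsProperFunction.toReal_valueFunction_sub_le (hq : IsProperFunction q) {x' : X} {y' : Y}
    (hy : y ∈ argminSet (decomposableObjective ψ q x))
    (hy' : y' ∈ argminSet (decomposableObjective ψ q x')) :
    (valueFunction (decomposableObjective ψ q) x').toReal
      - (valueFunction (decomposableObjective ψ q) x).toReal ≤ ψ (x', y) - ψ (x, y) := by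
  have h := mem_argminSet_iff.1 hy' y
  simp only [decomposableObjective] at h
  rw [← hq.coe_toReal_of_mem_argminSet hy, ← hq.coe_toReal_of_mem_argminSet hy', ← EReal.coe_add,
    ← EReal.coe_add, EReal.coe_le_coe_iff] at h
  rw [hq.valueFunction_eq_coe hy, hq.valueFunction_eq_coe hy', EReal.toReal_coe, EReal.toReal_coe]
  linarith

/-- Cluster points of minimizers of the perturbed problems minimize the limit problem. -/
theorem mem_argminSet_of_mapClusterPt [TopologicalSpace X] [TopologicalSpace Y]
    (hψ : Continuous ψ) (hq : IsProperFunction q) (hlsc : LowerSemicontinuous q)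
    {l : Filter X} (hl : l ≤ 𝓝 x) {σ : X → Y}
    (hσ : ∀ᶠ x' in l, σ x' ∈ argminSet (decomposableObjective ψ q x'))
    (hy : MapClusterPt y l σ) : y ∈ argminSet (decomposableObjective ψ q x) := by
  rw [mem_argminSet_iff]
  intro z
  by_contra! hlt
  have hz : q z ≠ ⊤ := by
    intro hz
    simp [decomposableObjective, hz] at hlt
  simp only [decomposableObjective] at hlt
  rw [← EReal.coe_toReal hz (hq.1 z), ← EReal.coe_add] at hlt
  set c := (q z).toReal
  -- `q y` may still be `⊤` here, so it stays isolated in `EReal`.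
  have hlt' : ((ψ (x, z) + c - ψ (x, y) : ℝ) : EReal) < q y := by
    induction h : q y with
    | bot => exact absurd h (hq.1 y)
    | top => exact EReal.coe_lt_top _
    | coe r =>
      rw [h, ← EReal.coe_add, EReal.coe_lt_coe_iff] at hlt
      rw [EReal.coe_lt_coe_iff]
      linarith
  -- Near `(x, y)`, continuity keeps the `ψ` side below `a` and semicontinuity keeps `q` above it; a
  -- minimizer `σ x'` close to `y` would then lose to `z`.
  obtain ⟨a, ha, hay⟩ := EReal.lt_iff_exists_real_btwn.1 hlt'
  rw [EReal.coe_lt_coe_iff] at ha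
  have hcont : Continuous fun p : X × Y => ψ (p.1, z) + c - ψ p := by fun_prop
  have hev : ∀ᶠ p : X × Y in 𝓝 x ×ˢ 𝓝 y, ψ (p.1, z) + c - ψ p < a := by
    rw [← nhds_prod_eq]
    exact hcont.continuousAt.eventually_lt_const ha
  obtain ⟨P, hP, R, hR, hPR⟩ := eventually_prod_iff.1 hev
  obtain ⟨x', ⟨hR', ha'⟩, hP', hmin⟩ :=
    ((hy.frequently (hR.and (hlsc y a hay))).and_eventually ((hP.filter_mono hl).and hσ)).exists
  have h1 := hPR hP' hR'
  have h2 := mem_argminSet_iff.1 hmin z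
  simp only [decomposableObjective] at h2
  rw [← hq.coe_toReal_of_mem_argminSet hmin, gt_iff_lt, EReal.coe_lt_coe_iff] at ha'
  rw [← hq.coe_toReal_of_mem_argminSet hmin, ← EReal.coe_toReal hz (hq.1 z), ← EReal.coe_add,
    ← EReal.coe_add, EReal.coe_le_coe_iff] at h2
  linarith

end Minimizers

theorem continuousOn_argmin {X Y : Type*} [TopologicalSpace X] [PseudoMetricSpace Y] [ProperSpace Y]
    {ψ : X × Y → ℝ} {q : Y → EReal} {Ω : Set X} {σ : X → Y}
    (hψ : Continuous ψ) (hq : IsProperFunction q) (hlsc : LowerSemicontinuous q)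
    (hσ : ∀ x ∈ Ω, argminSet (decomposableObjective ψ q x) = {σ x})
    (hbdd : ∀ x ∈ Ω, ∃ U ∈ 𝓝 x, Bornology.IsBounded (σ '' (U ∩ Ω))) : ContinuousOn σ Ω := by
  intro x hx
  obtain ⟨U, hU, hb⟩ := hbdd x hx
  refine hb.isCompact_closure.tendsto_nhds_of_unique_mapClusterPt ?_ fun y _ hy => ?_
  · filter_upwards [inter_mem_nhdsWithin Ω hU] with x' hx'
    exact subset_closure (mem_image_of_mem σ hx'.symm)
  · have hmem := mem_argminSet_of_mapClusterPt hψ hq hlsc nhdsWithin_le_nhds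
      (eventually_mem_nhdsWithin.mono fun x' hx' => by simp [hσ x' hx']) hy
    rwa [hσ x hx] at hmem

/-- **Danskin's theorem**, local form: an envelope `v` squeezed by the increments of `ψ` in its
first variable is differentiable, with derivative the partial derivative of `ψ`. -/
theorem hasFDerivAt_of_sub_le {E F : Type*} [NormedAddCommGroup E] [NormedSpace ℝ E]
    [NormedAddCommGroup F] [NormedSpace ℝ F] {ψ : E × F → ℝ} {ψ' : E × F →L[ℝ] ℝ} {v : E → ℝ}
    {σ : E → F} {x : E} (hψ : HasStrictFDerivAt ψ ψ' (x, σ x)) (hσ : ContinuousAt σ x)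
    (hle : ∀ᶠ x' in 𝓝 x, v x' - v x ≤ ψ (x', σ x) - ψ (x, σ x))
    (hge : ∀ᶠ x' in 𝓝 x, ψ (x', σ x') - ψ (x, σ x') ≤ v x' - v x) :
    HasFDerivAt v (ψ'.comp (ContinuousLinearMap.inl ℝ E F)) x := by
  -- The base point `(x, τ x')` moves with `x'`, hence strict differentiability. The constant `τ`
  -- serves the upper bound, `τ = σ` the lower.
  have key : ∀ τ : E → F, Tendsto τ (𝓝 x) (𝓝 (σ x)) →
      (fun x' => ψ (x', τ x') - ψ (x, τ x') - ψ' (x' - x, 0)) =o[𝓝 x] fun x' => x' - x := by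
    intro τ hτ
    have ht : Tendsto (fun x' => ((x', τ x'), (x, τ x'))) (𝓝 x) (𝓝 ((x, σ x), (x, σ x))) :=
      (tendsto_id.prodMk_nhds hτ).prodMk_nhds (tendsto_const_nhds.prodMk_nhds hτ)
    have h := hψ.isLittleO.comp_tendsto ht
    refine (h.congr_left fun x' => ?_).trans_isBigO (.of_bound' (.of_forall fun x' => ?_))
    · simp [-map_sub]
    · simp [Prod.norm_def]
  have h1 := key (fun _ => σ x) tendsto_const_nhds
  have h2 := key σ hσ
  refine .of_isLittleO ((Asymptotics.IsBigO.of_bound' ?_).trans_isLittleO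
    (h1.norm_left.add h2.norm_left))
  filter_upwards [hle, hge] with x' hx1 hx2
  simp only [ContinuousLinearMap.comp_apply, ContinuousLinearMap.inl_apply, Real.norm_eq_abs]
  set d := ψ' (x' - x, 0)
  rw [abs_of_nonneg (a := |_| + |_|) (by positivity), abs_le]
  have := le_abs_self (ψ (x', σ x) - ψ (x, σ x) - d)
  have := abs_nonneg (ψ (x', σ x) - ψ (x, σ x) - d)
  have := neg_abs_le (ψ (x', σ x') - ψ (x, σ x') - d)
  have := abs_nonneg (ψ (x', σ x') - ψ (x, σ x') - d)
  constructor <;> linarith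

theorem hasFDerivAt_toReal_valueFunction {E F : Type*} [NormedAddCommGroup E] [NormedSpace ℝ E]
    [NormedAddCommGroup F] [NormedSpace ℝ F] {ψ : E × F → ℝ} {ψ' : E × F →L[ℝ] ℝ} {q : F → EReal}
    {σ : E → F} {x : E} (hq : IsProperFunction q) (hψ : HasStrictFDerivAt ψ ψ' (x, σ x))
    (hσc : ContinuousAt σ x)
    (hσ : ∀ᶠ x' in 𝓝 x, σ x' ∈ argminSet (decomposableObjective ψ q x')) :
    HasFDerivAt (fun x' => (valueFunction (decomposableObjective ψ q) x').toReal)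
      (ψ'.comp (ContinuousLinearMap.inl ℝ E F)) x := by
  refine hasFDerivAt_of_sub_le hψ hσc ?_ ?_ <;> filter_upwards [hσ] with x' hx'
  · exact hq.toReal_valueFunction_sub_le hσ.self_of_nhds hx'
  · linarith [hq.toReal_valueFunction_sub_le hx' hσ.self_of_nhds]

theorem mainTheorem5 (n m : ℕ)
    (ψ : EuclideanSpace ℝ (Fin n) × EuclideanSpace ℝ (Fin m) → ℝ)
    (q : EuclideanSpace ℝ (Fin m) → EReal)
    (Ω : Set (EuclideanSpace ℝ (Fin n)))
    (σ : EuclideanSpace ℝ (Fin n) → EuclideanSpace ℝ (Fin m))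
    (hq_proper : IsProperFunction q)
    (hq_lsc : LowerSemicontinuous q)
    (hψ : ContDiff ℝ 2 ψ)
    (hΩ : IsOpen Ω)
    (hσ : ∀ x ∈ Ω, argminSet (decomposableObjective ψ q x) = {σ x})
    (hbdd : ∀ x ∈ Ω, ∃ U ∈ nhds x, Bornology.IsBounded (σ '' (U ∩ Ω))) :
    ContinuousOn σ Ω ∧
    (∀ x ∈ Ω, valueFunction (decomposableObjective ψ q) x ≠ ⊥ ∧
      valueFunction (decomposableObjective ψ q) x ≠ ⊤) ∧
    ContDiffOn ℝ 1 (fun x => (valueFunction (decomposableObjective ψ q) x).toReal) Ω ∧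
    (∀ x ∈ Ω, HasGradientAt (fun x' => (valueFunction (decomposableObjective ψ q) x').toReal)
      (gradient (fun x' => ψ (x', σ x)) x) x) := by
  have hmem : ∀ x ∈ Ω, σ x ∈ argminSet (decomposableObjective ψ q x) := fun x hx => by
    simp [hσ x hx]
  have hcont : ContinuousOn σ Ω := continuousOn_argmin hψ.continuous hq_proper hq_lsc hσ hbdd
  have hderiv : ∀ x ∈ Ω,
      HasFDerivAt (fun x' => (valueFunction (decomposableObjective ψ q) x').toReal)
        ((fderiv ℝ ψ (x, σ x)).comp (ContinuousLinearMap.inl ℝ _ _)) x := fun x hx =>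
    hasFDerivAt_toReal_valueFunction hq_proper (hψ.hasStrictFDerivAt two_ne_zero)
      (hcont.continuousAt (hΩ.mem_nhds hx)) ((hΩ.eventually_mem hx).mono hmem)
  refine ⟨hcont, fun x hx => ?_, ?_, fun x hx => ?_⟩
  · rw [hq_proper.valueFunction_eq_coe (hmem x hx)]
    exact ⟨EReal.coe_ne_bot _, EReal.coe_ne_top _⟩
  -- The analyticity clause of this criterion is vacuous, as the order is not `ω`.
  · rw [← zero_add (1 : WithTop ℕ∞), contDiffOn_succ_iff_fderiv_of_isOpen hΩ, contDiffOn_zero]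
    refine ⟨fun x hx => (hderiv x hx).differentiableAt.differentiableWithinAt, by simp, ?_⟩
    refine ContinuousOn.congr ?_ fun x hx => (hderiv x hx).fderiv
    exact ((hψ.continuous_fderiv two_ne_zero).comp_continuousOn
      (continuousOn_id.prodMk hcont)).clm_comp continuousOn_const
  · have hpart : HasFDerivAt (fun x' => ψ (x', σ x))
        ((fderiv ℝ ψ (x, σ x)).comp (ContinuousLinearMap.inl ℝ _ _)) x :=
      HasFDerivAt.comp x (hψ.differentiable two_ne_zero (x, σ x)).hasFDerivAt
        (hasFDerivAt_prodMk_left x (σ x))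
    rw [hasGradientAt_iff_hasFDerivAt, toDual_gradient, hpart.fderiv]
    exact hderiv x hx
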